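/- Let $\alpha\in(0,1)$, $\sigma=\sqrt{\alpha(1-\alpha)}$ and $\rho=\sigma/\alpha^{3/2}$. Let $W=(W(t))_{t\ge 0}$ be a standard Brownian motion started at the origin, either one-dimensional or two-dimensional (with independent coordinates), and put $W(t)=0$ for $t\le 0$. For $x>0$ and $t>0$ define the smooth Conga line $$\overline{u}(x,t)=\mathbb{E}_{Z_{\rho^2x}}\,W\!\left(t-\frac{x}{\alpha}-Z_{\rho^2x}\right),$$ where $Z_{\rho^2x}$ is normal with mean $0$ and variance $\rho^2x$, independent of $W$, and the expectation is taken with respect to $Z_{\rho^2x}$ only, for a fixed realisation of $W$. Fix $\eta\in\left(0,\frac{1-\alpha}{\alpha}\right)$ and, for $t>0$, put $x_t=\alpha(1+\eta)t$, $$v_t(\eta)=\sqrt{2\pi\rho^2\alpha(1+\eta)t}\;\exp\left\{\frac{\eta^2t}{2\rho^2\alpha(1+\eta)}\right\}\overline{u}(x_t,t),\qquad v(\eta)=\int_0^\infty\exp\left\{-\frac{s\eta}{\rho^2\alpha(1+\eta)}\right\}W(s)\,ds .$$ Almost surely, the integrals defining $v(\eta)$ and $\overline{u}(x_t,t)$ for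 all $t>0$ converge absolutely; the random variables $v_t(\eta)$ $(t>0)$ and $v(\eta)$ are square integrable; and, as $t\to\infty$ through the reals, $$v_t(\eta)\to v(\eta)\quad\text{almost surely and in } L^2 .$$ -/

import Mathlib

open MeasureTheory ProbabilityTheory Filter Topology
open scoped NNReal ENNReal

namespace CongaLine

/-- A standard planar Brownian motion started at the origin: its two coordinate processes are
independent standard one-dimensional Brownian motions (with almost surely continuous paths). -/
structure IsPlanarBrownian {Ω : Type*} [MeasurableSpace Ω]
    (W : ℝ≥0 → Ω → EuclideanSpace ℝ (Fin 2)) (P : Measure Ω) : Prop where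
  coord : ∀ i : Fin 2, IsBrownianReal (fun t ω => W t ω i) P
  indep : iIndepFun (fun (i : Fin 2) (ω : Ω) (t : ℝ≥0) => W t ω i) P

noncomputable section

/-- The parameter `σ = √(α (1 - α))`. -/
def sigma (α : ℝ) : ℝ := Real.sqrt (α * (1 - α))

/-- The parameter `ρ = σ / α ^ (3 / 2)`. -/
def rho (α : ℝ) : ℝ := sigma α / α ^ (3 / 2 : ℝ)

variable {Ω : Type*} {E : Type*} [NormedAddCommGroup E] [NormedSpace ℝ E]

/-- The driving process, extended to all real times by `W(r) = 0` for `r ≤ 0`. -/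
def extend (W : ℝ≥0 → Ω → E) (r : ℝ) (ω : Ω) : E :=
  if 0 < r then W r.toNNReal ω else 0

/-- The law of `Z_{ρ² x}`: the centred normal distribution with variance `ρ² x`. -/
def smoothingLaw (α x : ℝ) : Measure ℝ := gaussianReal 0 (rho α ^ 2 * x).toNNReal

/-- The smooth Conga line `ū(x, t) = 𝔼_Z W(t - x / α - Z)`, where `Z` is centred normal with
variance `ρ² x` and the expectation is over `Z` only, for a fixed realisation of `W`. -/
def uBar (α : ℝ) (W : ℝ≥0 → Ω → E) (x t : ℝ) (ω : Ω) : E :=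
  ∫ z, extend W (t - x / α - z) ω ∂(smoothingLaw α x)

/-- The distance from the tip `x_t = α (1 + η) t`. -/
def tailPos (α η t : ℝ) : ℝ := α * (1 + η) * t

/-- The rescaled tail
`v_t(η) = √(2 π ρ² α (1 + η) t) · exp (η² t / (2 ρ² α (1 + η))) · ū(x_t, t)`. -/
def vScaled (α η : ℝ) (W : ℝ≥0 → Ω → E) (t : ℝ) (ω : Ω) : E :=
  (Real.sqrt (2 * Real.pi * rho α ^ 2 * α * (1 + η) * t) *
    Real.exp (η ^ 2 * t / (2 * rho α ^ 2 * α * (1 + η)))) • uBar α W (tailPos α η t) t ω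

/-- The integrand `exp (- s η / (ρ² α (1 + η))) W(s)` of the limit. -/
def limitIntegrand (α η : ℝ) (W : ℝ≥0 → Ω → E) (ω : Ω) (s : ℝ) : E :=
  Real.exp (-(s * η / (rho α ^ 2 * α * (1 + η)))) • extend W s ω

/-- The limit `v(η) = ∫₀^∞ exp (- s η / (ρ² α (1 + η))) W(s) ds`. -/
def vLimit (α η : ℝ) (W : ℝ≥0 → Ω → E) (ω : Ω) : E :=
  ∫ s in Set.Ioi (0 : ℝ), limitIntegrand α η W ω s

end

end CongaLine

/-! Since `t - x_t / α = -η t`, the tail `ū(x_t, t)` integrates `W(s)` against a centred Gaussian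
density of variance `c t`, `c = ρ² α (1 + η)`, at the point `-(η t) - s`. Expanding the square, the
prefactor of `v_t` cancels everything independent of `s`, leaving the exact formula `v_t = ∫₀^∞
e^{-s²/(2ct)} e^{-sη/c} W(s) ds` (`vScaled_eq_integral`). The extra factor lies in `[0, 1]` and
tends to `1`, so dominated convergence gives the pathwise limit once `∫₀^∞ e^{-sη/c} |W(s)| ds`
(`mass`) is finite. By Cauchy–Schwarz and `𝔼|W(s)|² ≤ d s`, `mass` is square integrable; it bounds
`v_t` and `v` uniformly in `t`, so it also dominates in `L²`. Only path continuity and linear second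
moments matter, so `tail_convergence` serves both dimensions. -/

namespace CongaLine

/-! ### Measurability of the extended process -/

section Measurability

variable {Ω E : Type*} [MeasurableSpace Ω] [NormedAddCommGroup E] {P : Measure Ω}
  {W : ℝ≥0 → Ω → E}

/-- A process with almost surely continuous paths is jointly measurable up to a null set. -/
theorem aestronglyMeasurable_extend [MeasurableSpace E] [BorelSpace E]
    [SecondCountableTopology E] [SFinite P] (hmeas : ∀ t, AEStronglyMeasurable (W t) P)
    (hcont : ∀ᵐ ω ∂P, Continuous (W · ω)) :
    AEStronglyMeasurable (fun p : Ω × ℝ => extend W p.2 p.1) (P.prod volume) := by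
  -- Sampling at the grid point of mesh `1 / (n + 1)` just below the time involves countably many
  -- variables; path continuity then gives the limit in `n`.
  let grid : ℕ → ℕ → ℝ≥0 := fun n m => Real.toNNReal ((m : ℝ) / ((n : ℝ) + 1))
  have hgrid : ∀ n : ℕ, AEStronglyMeasurable
      (fun p : Ω × ℝ => W (grid n ⌊max p.2 0 * ((n : ℝ) + 1)⌋₊) p.1) (P.prod volume) := by
    intro n
    refine ⟨fun p => (hmeas (grid n ⌊max p.2 0 * ((n : ℝ) + 1)⌋₊)).mk _ p.1, ?_, ?_⟩
    · have h : Measurable (fun q : Ω × ℕ => (hmeas (grid n q.2)).mk _ q.1) :=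
        measurable_from_prod_countable_left fun m =>
          (hmeas (grid n m)).stronglyMeasurable_mk.measurable
      refine Measurable.stronglyMeasurable (h.comp (g := fun q : Ω × ℕ =>
        (hmeas (grid n q.2)).mk _ q.1) (f := fun p : Ω × ℝ =>
        (p.1, ⌊max p.2 0 * ((n : ℝ) + 1)⌋₊)) ?_)
      refine measurable_fst.prodMk (Nat.measurable_floor.comp ?_)
      fun_prop
    · have h : ∀ᵐ ω ∂P, ∀ m : ℕ, W (grid n m) ω = (hmeas (grid n m)).mk _ ω :=
        ae_all_iff.2 fun m => (hmeas _).ae_eq_mk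
      filter_upwards [Measure.quasiMeasurePreserving_fst.ae h] with p hp using hp _
  have hW : AEStronglyMeasurable (fun p : Ω × ℝ => W p.2.toNNReal p.1) (P.prod volume) := by
    refine aestronglyMeasurable_of_tendsto_ae atTop hgrid ?_
    filter_upwards [Measure.quasiMeasurePreserving_fst.ae hcont] with p hp
    refine (hp.tendsto p.2.toNNReal).comp ?_
    have h1 := tendsto_nat_floor_mul_div_atTop (le_max_right p.2 0)
    have h2 : Tendsto (fun n : ℕ => (n : ℝ) + 1) atTop atTop :=
      tendsto_atTop_add_const_right _ _ tendsto_natCast_atTop_atTop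
    have h3 := (continuous_real_toNNReal.tendsto _).comp (h1.comp h2)
    have h4 : (max p.2 0).toNNReal = p.2.toNNReal := by
      rw [← Real.coe_toNNReal', Real.toNNReal_coe]
    rwa [h4] at h3
  have hind : (fun p : Ω × ℝ => extend W p.2 p.1) =
      (Prod.snd ⁻¹' Set.Ioi (0 : ℝ)).indicator (fun p : Ω × ℝ => W p.2.toNNReal p.1) := by
    ext p
    by_cases h : 0 < p.2 <;> simp [extend, h]
  rw [hind]
  exact hW.indicator (measurable_snd measurableSet_Ioi)

/-- Almost every extended path is measurable. -/
theorem ae_aestronglyMeasurable_extend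
    (hcont : ∀ᵐ ω ∂P, Continuous (W · ω)) :
    ∀ᵐ ω ∂P, AEStronglyMeasurable (fun s => extend W s ω) volume := by
  filter_upwards [hcont] with ω hω
  have hind : (fun s => extend W s ω) =
      (Set.Ioi (0 : ℝ)).indicator (fun s => W s.toNNReal ω) := by
    ext s
    simp [extend, Set.indicator_apply]
  rw [hind]
  exact ((hω.comp continuous_real_toNNReal).aestronglyMeasurable).indicator measurableSet_Ioi

end Measurability

/-! ### Exponentially weighted second moments -/

section Moments

variable {Ω E : Type*} [NormedAddCommGroup E] {W : ℝ≥0 → Ω → E}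

theorem lintegral_exp_neg_mul_lt_top {k : ℝ} (hk : 0 < k) :
    ∫⁻ s in Set.Ioi (0 : ℝ), ENNReal.ofReal (Real.exp (-(s * k))) < ∞ := by
  have h := exp_neg_integrableOn_Ioi 0 hk
  have h2 := h.lintegral_lt_top
  refine lt_of_eq_of_lt ?_ h2
  congr with s
  ring_nf

theorem lintegral_exp_neg_mul_mul_lt_top {k : ℝ} (hk : 0 < k) :
    ∫⁻ s in Set.Ioi (0 : ℝ), ENNReal.ofReal (Real.exp (-(s * k))) * ENNReal.ofReal s < ∞ := by
  have h := integrableOn_rpow_mul_exp_neg_mul_rpow (s := 1) (p := 1) (by norm_num) one_pos hk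
  refine lt_of_eq_of_lt ?_ h.lintegral_lt_top
  refine lintegral_congr fun s => ?_
  rw [← ENNReal.ofReal_mul (Real.exp_nonneg _), Real.rpow_one]
  ring_nf

/-- The weighted energy `∫₀^∞ e^{-ks} |W(s)|² ds` of a path. -/
noncomputable def energy (k : ℝ) (W : ℝ≥0 → Ω → E) (ω : Ω) : ℝ≥0∞ :=
  ∫⁻ s in Set.Ioi (0 : ℝ), ENNReal.ofReal (Real.exp (-(s * k))) * ‖extend W s ω‖ₑ ^ 2

/-- The weighted mass `∫₀^∞ e^{-ks} |W(s)| ds` of a path. -/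
noncomputable def mass (k : ℝ) (W : ℝ≥0 → Ω → E) (ω : Ω) : ℝ≥0∞ :=
  ∫⁻ s in Set.Ioi (0 : ℝ), ENNReal.ofReal (Real.exp (-(s * k))) * ‖extend W s ω‖ₑ

/-- Tonelli reduces the claim to `d ∫₀^∞ s e^{-ks} ds < ∞`. -/
theorem lintegral_energy_lt_top [MeasurableSpace Ω] {P : Measure Ω} [SFinite P] {k : ℝ} (hk : 0 < k) {d : ℝ≥0∞} (hd : d ≠ ∞)
    (hW : AEStronglyMeasurable (fun p : Ω × ℝ => extend W p.2 p.1) (P.prod volume))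
    (hmom : ∀ t : ℝ≥0, ∫⁻ ω, ‖W t ω‖ₑ ^ 2 ∂P ≤ d * t) :
    ∫⁻ ω, energy k W ω ∂P < ∞ := by
  have hWr : AEMeasurable (fun p : Ω × ℝ =>
      ENNReal.ofReal (Real.exp (-(p.2 * k))) * ‖extend W p.2 p.1‖ₑ ^ 2)
      (P.prod (volume.restrict (Set.Ioi 0))) := by
    have h : P.prod (volume.restrict (Set.Ioi (0 : ℝ))) ≪ P.prod volume :=
      Measure.AbsolutelyContinuous.rfl.prod Measure.restrict_le_self.absolutelyContinuous
    have hexp : Measurable (fun p : Ω × ℝ => ENNReal.ofReal (Real.exp (-(p.2 * k)))) := by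
      fun_prop
    refine hexp.aemeasurable.mul ?_
    exact ((hW.mono_ac h).enorm).pow_const 2
  unfold energy
  rw [lintegral_lintegral_swap hWr]
  calc ∫⁻ s in Set.Ioi (0 : ℝ), ∫⁻ ω,
        ENNReal.ofReal (Real.exp (-(s * k))) * ‖extend W s ω‖ₑ ^ 2 ∂P
      ≤ ∫⁻ s in Set.Ioi (0 : ℝ),
        d * (ENNReal.ofReal (Real.exp (-(s * k))) * ENNReal.ofReal s) := by
        refine setLIntegral_mono (by fun_prop) fun s hs => ?_
        rw [lintegral_const_mul' _ _ ENNReal.ofReal_ne_top, mul_left_comm]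
        gcongr
        simp only [extend, Set.mem_Ioi.1 hs, if_true]
        exact hmom s.toNNReal
    _ < ∞ := by
        rw [lintegral_const_mul' _ _ hd]
        exact ENNReal.mul_lt_top hd.lt_top (lintegral_exp_neg_mul_mul_lt_top hk)

/-- Cauchy–Schwarz after splitting `e^{-ks} = e^{-ks/2} · e^{-ks/2}` and leaving one half with the
path. -/
theorem mass_sq_le {k : ℝ} {ω : Ω}
    (hW : AEStronglyMeasurable (fun s => extend W s ω) volume) :
    mass k W ω ^ 2 ≤
      (∫⁻ s in Set.Ioi (0 : ℝ), ENNReal.ofReal (Real.exp (-(s * k)))) * energy k W ω := by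
  set e : ℝ → ℝ≥0∞ := fun s => ENNReal.ofReal (Real.exp (-(s * (k / 2)))) with he
  have hee : ∀ s, ENNReal.ofReal (Real.exp (-(s * k))) = e s ^ 2 := by
    intro s
    rw [he, ← ENNReal.ofReal_pow (Real.exp_nonneg _), ← Real.exp_nat_mul]
    congr 2
    push_cast
    ring
  have hem : Measurable e := by fun_prop
  have hWr : AEMeasurable (fun s => ‖extend W s ω‖ₑ) (volume.restrict (Set.Ioi 0)) :=
    hW.restrict.enorm
  have h := ENNReal.lintegral_mul_le_Lp_mul_Lq (volume.restrict (Set.Ioi (0 : ℝ)))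
    Real.HolderConjugate.two_two hem.aemeasurable (hem.aemeasurable.mul hWr)
  unfold mass energy
  have h1 : ∫⁻ s in Set.Ioi (0 : ℝ), ENNReal.ofReal (Real.exp (-(s * k))) * ‖extend W s ω‖ₑ =
      ∫⁻ s in Set.Ioi (0 : ℝ), (e * (e * fun s => ‖extend W s ω‖ₑ)) s := by
    refine lintegral_congr fun s => ?_
    simp only [hee, Pi.mul_apply]
    ring
  rw [h1]
  refine (pow_le_pow_left' h 2).trans (le_of_eq ?_)
  rw [mul_pow, ← ENNReal.rpow_natCast, ← ENNReal.rpow_natCast, ← ENNReal.rpow_mul,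
    ← ENNReal.rpow_mul]
  simp only [hee, Pi.mul_apply, ENNReal.rpow_two, mul_pow]
  norm_num

end Moments

/-! ### Pathwise formula, bounds and limit -/

section Paths

variable {Ω E : Type*} [NormedAddCommGroup E] [NormedSpace ℝ E] {W : ℝ≥0 → Ω → E} {α η : ℝ}

theorem rho_pos (hα : α ∈ Set.Ioo (0 : ℝ) 1) : 0 < rho α := by
  have h0 := hα.1
  have h1 : 0 < 1 - α := sub_pos.2 hα.2
  unfold rho sigma
  positivity

/-- The variance per unit time `ρ² α (1 + η)` of the smoothing law along the tail. -/
noncomputable def tailVar (α η : ℝ) : ℝ := rho α ^ 2 * α * (1 + η)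

theorem tailVar_pos (hα : α ∈ Set.Ioo (0 : ℝ) 1) (hη : 0 < η) : 0 < tailVar α η := by
  have h0 := hα.1
  have h1 := rho_pos hα
  unfold tailVar
  positivity

theorem smoothingLaw_tailPos (α η t : ℝ) :
    smoothingLaw α (tailPos α η t) = gaussianReal 0 (tailVar α η * t).toNNReal := by
  unfold smoothingLaw tailPos tailVar
  congr 2
  ring

theorem sub_tailPos_div (hα : 0 < α) (η t : ℝ) : t - tailPos α η t / α = -(η * t) := by
  unfold tailPos
  field_simp
  ring

theorem limitIntegrand_eq (α η : ℝ) (W : ℝ≥0 → Ω → E) (ω : Ω) (s : ℝ) :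
    limitIntegrand α η W ω s =
      Real.exp (-(s * (η / tailVar α η))) • extend W s ω := by
  unfold limitIntegrand tailVar
  rw [mul_div_assoc]

theorem limitIntegrand_of_nonpos (α η : ℝ) (W : ℝ≥0 → Ω → E) (ω : Ω) {s : ℝ} (hs : s ≤ 0) :
    limitIntegrand α η W ω s = 0 := by
  simp [limitIntegrand, extend, hs.not_gt]

/-- The Gaussian density seen from the tail factors through the exponential weight. -/
theorem gaussianPDFReal_tail {c : ℝ} (hc : 0 < c) {t : ℝ} (ht : 0 < t) (η s : ℝ) :
    gaussianPDFReal 0 (c * t).toNNReal (-(η * t) - s) =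
      (Real.sqrt (2 * Real.pi * c * t) * Real.exp (η ^ 2 * t / (2 * c)))⁻¹ *
        (Real.exp (-(s ^ 2 / (2 * c * t))) * Real.exp (-(s * (η / c)))) := by
  rw [gaussianPDFReal, Real.coe_toNNReal _ (mul_pos hc ht).le, mul_inv, ← Real.exp_neg, ← Real.exp_add,
    mul_assoc (√_)⁻¹, ← Real.exp_add, mul_assoc (2 * Real.pi)]
  congr 2
  -- The exponents match because `(ηt + s)² / (2ct) = η²t / (2c) + sη / c + s² / (2ct)`.
  field_simp
  ring

/-- Substitute `s = -(η t) - z` and use that `W` vanishes at nonpositive times. No integrability is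
needed: the rules used also respect the default value `0` of the integral, so the identity holds for
every `ω`. -/
theorem vScaled_eq_integral (hα : α ∈ Set.Ioo (0 : ℝ) 1) (hη : 0 < η) {t : ℝ} (ht : 0 < t)
    (ω : Ω) :
    vScaled α η W t ω = ∫ s in Set.Ioi (0 : ℝ),
      Real.exp (-(s ^ 2 / (2 * tailVar α η * t))) • limitIntegrand α η W ω s := by
  have hc := tailVar_pos hα hη
  have hv : (tailVar α η * t).toNNReal ≠ 0 := (Real.toNNReal_pos.2 (mul_pos hc ht)).ne'
  have hfac : Real.sqrt (2 * Real.pi * rho α ^ 2 * α * (1 + η) * t) *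
      Real.exp (η ^ 2 * t / (2 * rho α ^ 2 * α * (1 + η))) =
      Real.sqrt (2 * Real.pi * tailVar α η * t) *
        Real.exp (η ^ 2 * t / (2 * tailVar α η)) := by
    unfold tailVar
    simp only [mul_assoc]
  have hne : Real.sqrt (2 * Real.pi * tailVar α η * t) *
      Real.exp (η ^ 2 * t / (2 * tailVar α η)) ≠ 0 := by positivity
  rw [vScaled, hfac, uBar, smoothingLaw_tailPos, integral_gaussianReal_eq_integral_smul hv,
    ← integral_smul, ← integral_sub_left_eq_self _ volume (-(η * t)),
    setIntegral_eq_integral_of_forall_compl_eq_zero]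
  · refine integral_congr_ae (ae_of_all _ fun s => ?_)
    simp only
    rw [gaussianPDFReal_tail hc ht, sub_tailPos_div hα.1, sub_sub_cancel, smul_smul,
      mul_inv_cancel_left₀ hne, limitIntegrand_eq, smul_smul]
  · intro s hs
    rw [limitIntegrand_of_nonpos α η W ω (not_lt.1 hs), smul_zero]

theorem exp_neg_sq_div_le_one {c t : ℝ} (hc : 0 < c) (ht : 0 < t) (s : ℝ) :
    Real.exp (-(s ^ 2 / (2 * c * t))) ≤ 1 := by
  rw [Real.exp_le_one_iff, neg_nonpos]
  positivity

/-- After the same substitution the integrand is `limitIntegrand` times a bounded factor. -/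
theorem integrable_smoothing (hα : α ∈ Set.Ioo (0 : ℝ) 1) (hη : 0 < η) {ω : Ω}
    (h : IntegrableOn (limitIntegrand α η W ω) (Set.Ioi 0)) {t : ℝ} (ht : 0 < t) :
    Integrable (fun z => extend W (t - tailPos α η t / α - z) ω)
      (smoothingLaw α (tailPos α η t)) := by
  have hc := tailVar_pos hα hη
  have hv : (tailVar α η * t).toNNReal ≠ 0 := (Real.toNNReal_pos.2 (mul_pos hc ht)).ne'
  have hint : Integrable (limitIntegrand α η W ω) volume := by
    refine (integrableOn_iff_integrable_of_support_subset fun s hs => ?_).1 h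
    by_contra hs'
    exact hs (limitIntegrand_of_nonpos α η W ω (not_lt.1 hs'))
  rw [smoothingLaw_tailPos, gaussianReal_of_var_ne_zero _ hv,
    integrable_withDensity_iff_integrable_smul' (measurable_gaussianPDF _ _)
      (ae_of_all _ fun _ => gaussianPDF_lt_top)]
  simp only [toReal_gaussianPDF, sub_tailPos_div hα.1]
  have hg : Integrable (fun s =>
      ((Real.sqrt (2 * Real.pi * tailVar α η * t) *
        Real.exp (η ^ 2 * t / (2 * tailVar α η)))⁻¹ * Real.exp (-(s ^ 2 / (2 * tailVar α η * t)))) •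
          limitIntegrand α η W ω s) volume := by
    refine hint.bdd_smul (Real.sqrt (2 * Real.pi * tailVar α η * t) *
        Real.exp (η ^ 2 * t / (2 * tailVar α η)))⁻¹ ?_ (ae_of_all _ fun s => ?_)
    · fun_prop
    · rw [Real.norm_of_nonneg (by positivity)]
      exact mul_le_of_le_one_right (by positivity) (exp_neg_sq_div_le_one hc ht s)
  refine (hg.comp_sub_left (-(η * t))).congr (ae_of_all _ fun z => ?_)
  have hz := gaussianPDFReal_tail hc ht η (-(η * t) - z)
  rw [sub_sub_cancel] at hz
  simp only [hz, limitIntegrand_eq, smul_smul, mul_assoc]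

theorem tendsto_vScaled (hα : α ∈ Set.Ioo (0 : ℝ) 1) (hη : 0 < η) {ω : Ω}
    (h : IntegrableOn (limitIntegrand α η W ω) (Set.Ioi 0)) :
    Tendsto (fun t : ℝ => vScaled α η W t ω) atTop (𝓝 (vLimit α η W ω)) := by
  have hc := tailVar_pos hα hη
  have hlim : Tendsto (fun t : ℝ => ∫ s in Set.Ioi (0 : ℝ),
      Real.exp (-(s ^ 2 / (2 * tailVar α η * t))) • limitIntegrand α η W ω s) atTop
      (𝓝 (vLimit α η W ω)) := by
    refine tendsto_integral_filter_of_dominated_convergence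
      (fun s => ‖limitIntegrand α η W ω s‖) ?_ ?_ h.norm ?_
    · refine Eventually.of_forall fun t => AEStronglyMeasurable.smul ?_ h.aestronglyMeasurable
      fun_prop
    · filter_upwards [eventually_gt_atTop 0] with t ht
      refine ae_of_all _ fun s => ?_
      rw [norm_smul, Real.norm_of_nonneg (Real.exp_nonneg _)]
      exact mul_le_of_le_one_left (norm_nonneg _) (exp_neg_sq_div_le_one hc ht s)
    · refine ae_of_all _ fun s => ?_
      have h1 : Tendsto (fun t : ℝ => 2 * tailVar α η * t) atTop atTop :=
        tendsto_id.const_mul_atTop (by positivity)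
      have h2 := (Real.continuous_exp.tendsto _).comp (h1.const_div_atTop (s ^ 2)).neg
      simpa using h2.smul_const (limitIntegrand α η W ω s)
  refine hlim.congr' ?_
  filter_upwards [eventually_gt_atTop 0] with t ht
  exact (vScaled_eq_integral hα hη ht ω).symm

theorem enorm_limitIntegrand (α η : ℝ) (W : ℝ≥0 → Ω → E) (ω : Ω) (s : ℝ) :
    ‖limitIntegrand α η W ω s‖ₑ =
      ENNReal.ofReal (Real.exp (-(s * (η / tailVar α η)))) * ‖extend W s ω‖ₑ := by
  rw [limitIntegrand_eq, enorm_smul, Real.enorm_of_nonneg (Real.exp_nonneg _)]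

theorem enorm_vLimit_le (α η : ℝ) (W : ℝ≥0 → Ω → E) (ω : Ω) :
    ‖vLimit α η W ω‖ₑ ≤ mass (η / tailVar α η) W ω := by
  refine (enorm_integral_le_lintegral_enorm _).trans (le_of_eq ?_)
  exact lintegral_congr fun s => enorm_limitIntegrand α η W ω s

theorem enorm_vScaled_le (hα : α ∈ Set.Ioo (0 : ℝ) 1) (hη : 0 < η) {t : ℝ} (ht : 0 < t)
    (ω : Ω) : ‖vScaled α η W t ω‖ₑ ≤ mass (η / tailVar α η) W ω := by
  rw [vScaled_eq_integral hα hη ht]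
  refine (enorm_integral_le_lintegral_enorm _).trans (lintegral_mono fun s => ?_)
  rw [← enorm_limitIntegrand, enorm_smul, Real.enorm_of_nonneg (Real.exp_nonneg _)]
  refine mul_le_of_le_one_left' ?_
  exact ENNReal.ofReal_le_one.2 (exp_neg_sq_div_le_one (tailVar_pos hα hη) ht s)

end Paths

/-! ### Almost sure and `L²` convergence -/

section Convergence

variable {Ω E : Type*} [MeasurableSpace Ω] [NormedAddCommGroup E]
  {W : ℝ≥0 → Ω → E} {P : Measure Ω} {α η : ℝ}

theorem lintegral_mass_sq_lt_top [SFinite P] {k : ℝ} (hk : 0 < k) {d : ℝ≥0∞} (hd : d ≠ ∞)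
    (hW : AEStronglyMeasurable (fun p : Ω × ℝ => extend W p.2 p.1) (P.prod volume))
    (hcont : ∀ᵐ ω ∂P, Continuous (W · ω))
    (hmom : ∀ t : ℝ≥0, ∫⁻ ω, ‖W t ω‖ₑ ^ 2 ∂P ≤ d * t) :
    ∫⁻ ω, mass k W ω ^ 2 ∂P < ∞ := by
  have hM := lintegral_exp_neg_mul_lt_top hk
  calc ∫⁻ ω, mass k W ω ^ 2 ∂P
      ≤ ∫⁻ ω, (∫⁻ s in Set.Ioi (0 : ℝ), ENNReal.ofReal (Real.exp (-(s * k)))) *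
          energy k W ω ∂P := by
        refine lintegral_mono_ae ?_
        filter_upwards [ae_aestronglyMeasurable_extend hcont] with ω hω
        exact mass_sq_le hω
    _ < ∞ := by
        rw [lintegral_const_mul' _ _ hM.ne]
        exact ENNReal.mul_lt_top hM (lintegral_energy_lt_top hk hd hW hmom)

theorem aemeasurable_mass [SFinite P] (k : ℝ)
    (hW : AEStronglyMeasurable (fun p : Ω × ℝ => extend W p.2 p.1) (P.prod volume)) :
    AEMeasurable (mass k W) P := by
  have h : P.prod (volume.restrict (Set.Ioi (0 : ℝ))) ≪ P.prod volume :=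
    Measure.AbsolutelyContinuous.rfl.prod Measure.restrict_le_self.absolutelyContinuous
  have hexp : Measurable (fun p : Ω × ℝ => ENNReal.ofReal (Real.exp (-(p.2 * k)))) := by
    fun_prop
  exact (hexp.aemeasurable.mul (hW.mono_ac h).enorm).lintegral_prod_right'

/-- A measurable function dominated by a square integrable one is square integrable. -/
theorem memLp_two_of_enorm_le {f : Ω → E} {g : Ω → ℝ≥0∞} (hf : AEStronglyMeasurable f P)
    (hfg : ∀ ω, ‖f ω‖ₑ ≤ g ω) (hg : ∫⁻ ω, g ω ^ 2 ∂P < ∞) : MemLp f 2 P := by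
  refine ⟨hf, ?_⟩
  rw [eLpNorm_lt_top_iff_lintegral_rpow_enorm_lt_top two_ne_zero ENNReal.ofNat_ne_top]
  refine lt_of_le_of_lt (lintegral_mono fun ω => ?_) hg
  simp only [ENNReal.toReal_ofNat, ENNReal.rpow_two]
  gcongr
  exact hfg ω

/-- Dominated convergence in `L²` along a countably generated filter. -/
theorem tendsto_eLpNorm_two_of_dominated {ι : Type*} {l : Filter ι} [l.IsCountablyGenerated]
    {f : ι → Ω → E} {f' : Ω → E} {g : Ω → ℝ≥0∞}
    (hf : ∀ᶠ i in l, AEStronglyMeasurable (f i) P) (hf' : AEStronglyMeasurable f' P)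
    (hfg : ∀ᶠ i in l, ∀ ω, ‖f i ω‖ₑ ≤ g ω) (hfg' : ∀ ω, ‖f' ω‖ₑ ≤ g ω)
    (hg : ∫⁻ ω, g ω ^ 2 ∂P < ∞)
    (hlim : ∀ᵐ ω ∂P, Tendsto (fun i => f i ω) l (𝓝 (f' ω))) :
    Tendsto (fun i => eLpNorm (f i - f') 2 P) l (𝓝 0) := by
  have h : Tendsto (fun i => ∫⁻ ω, ‖f i ω - f' ω‖ₑ ^ 2 ∂P) l (𝓝 (∫⁻ _, 0 ∂P)) := by
    -- The bound `4 g²` is the square of `‖f i - f'‖ ≤ 2 g`.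
    refine tendsto_lintegral_filter_of_dominated_convergence' (fun ω => 4 * g ω ^ 2) ?_ ?_ ?_ ?_
    · filter_upwards [hf] with i hi
      exact ((hi.sub hf').enorm).pow_const 2
    · filter_upwards [hfg] with i hi
      refine ae_of_all _ fun ω => ?_
      calc ‖f i ω - f' ω‖ₑ ^ 2 ≤ (g ω + g ω) ^ 2 := by
            gcongr
            exact enorm_sub_le.trans (add_le_add (hi ω) (hfg' ω))
        _ = 4 * g ω ^ 2 := by ring
    · rw [lintegral_const_mul' _ _ (by simp)]
      exact ENNReal.mul_ne_top (by simp) hg.ne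
    · filter_upwards [hlim] with ω hω
      have h1 := (hω.sub_const (f' ω)).enorm
      have h2 := ((ENNReal.continuous_pow 2).tendsto _).comp h1
      simpa [Function.comp_def] using h2
  have h2 := ((ENNReal.continuous_rpow_const (y := (1 / 2 : ℝ))).tendsto _).comp h
  simp only [lintegral_zero] at h2
  rw [ENNReal.zero_rpow_of_pos (by norm_num)] at h2
  refine h2.congr fun i => ?_
  rw [eLpNorm_eq_lintegral_rpow_enorm_toReal two_ne_zero ENNReal.ofNat_ne_top]
  simp

variable [NormedSpace ℝ E]

/-- Applied with `f = 1` for `v` and with the Gaussian factor for `v_t`. -/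
theorem aestronglyMeasurable_integral_smul_limitIntegrand [SFinite P] {f : ℝ → ℝ}
    (hf : Continuous f) (α η : ℝ)
    (hW : AEStronglyMeasurable (fun p : Ω × ℝ => extend W p.2 p.1) (P.prod volume)) :
    AEStronglyMeasurable
      (fun ω => ∫ s in Set.Ioi (0 : ℝ), f s • limitIntegrand α η W ω s) P := by
  have h : P.prod (volume.restrict (Set.Ioi (0 : ℝ))) ≪ P.prod volume :=
    Measure.AbsolutelyContinuous.rfl.prod Measure.restrict_le_self.absolutelyContinuous
  have h1 : StronglyMeasurable (fun p : Ω × ℝ =>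
      f p.2 * Real.exp (-(p.2 * (η / tailVar α η)))) := by
    refine Measurable.stronglyMeasurable ?_
    have := hf.measurable
    fun_prop
  have h2 : AEStronglyMeasurable (fun p : Ω × ℝ => f p.2 • limitIntegrand α η W p.1 p.2)
      (P.prod (volume.restrict (Set.Ioi (0 : ℝ)))) := by
    simp only [limitIntegrand_eq, smul_smul]
    exact h1.aestronglyMeasurable.smul (hW.mono_ac h)
  exact h2.integral_prod_right'

/-- The rescaled tail converges for every continuous process whose second moments grow at most
linearly. -/
theorem tail_convergence [MeasurableSpace E] [BorelSpace E] [SecondCountableTopology E]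
    [SFinite P] (hα : α ∈ Set.Ioo (0 : ℝ) 1) (hη : 0 < η) {d : ℝ≥0∞} (hd : d ≠ ∞)
    (hmeas : ∀ t, AEStronglyMeasurable (W t) P) (hcont : ∀ᵐ ω ∂P, Continuous (W · ω))
    (hmom : ∀ t : ℝ≥0, ∫⁻ ω, ‖W t ω‖ₑ ^ 2 ∂P ≤ d * t) :
    (∀ᵐ ω ∂P, (∀ t : ℝ, 0 < t → Integrable
        (fun z => extend W (t - tailPos α η t / α - z) ω) (smoothingLaw α (tailPos α η t))) ∧
      IntegrableOn (limitIntegrand α η W ω) (Set.Ioi 0)) ∧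
    (∀ᵐ ω ∂P, Tendsto (fun t : ℝ => vScaled α η W t ω) atTop (𝓝 (vLimit α η W ω))) ∧
    (∀ t : ℝ, 0 < t → MemLp (vScaled α η W t) 2 P) ∧
    MemLp (vLimit α η W) 2 P ∧
    Tendsto (fun t : ℝ => eLpNorm (vScaled α η W t - vLimit α η W) 2 P) atTop (𝓝 0) := by
  have hk : 0 < η / tailVar α η := div_pos hη (tailVar_pos hα hη)
  have hW := aestronglyMeasurable_extend hmeas hcont
  have hsq := lintegral_mass_sq_lt_top hk hd hW hcont hmom
  have hint : ∀ᵐ ω ∂P, IntegrableOn (limitIntegrand α η W ω) (Set.Ioi 0) := by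
    filter_upwards [ae_aestronglyMeasurable_extend hcont,
      ae_lt_top' ((aemeasurable_mass (η / tailVar α η) hW).pow_const 2) hsq.ne] with ω h1 h2
    refine ⟨?_, ?_⟩
    · simp only [funext (limitIntegrand_eq α η W ω)]
      refine AEStronglyMeasurable.smul ?_ h1.restrict
      fun_prop
    · rw [hasFiniteIntegral_iff_enorm]
      simp only [enorm_limitIntegrand]
      exact (ENNReal.pow_lt_top_iff.1 h2).resolve_right two_ne_zero
  have hlim : ∀ᵐ ω ∂P,
      Tendsto (fun t : ℝ => vScaled α η W t ω) atTop (𝓝 (vLimit α η W ω)) := by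
    filter_upwards [hint] with ω hω using tendsto_vScaled hα hη hω
  have hv : AEStronglyMeasurable (vLimit α η W) P := by
    have h := aestronglyMeasurable_integral_smul_limitIntegrand
      (f := fun _ => 1) continuous_const α η hW
    simp only [one_smul] at h
    exact h
  have hvt : ∀ t : ℝ, 0 < t → AEStronglyMeasurable (vScaled α η W t) P := fun t ht => by
    simp only [funext (vScaled_eq_integral hα hη ht)]
    exact aestronglyMeasurable_integral_smul_limitIntegrand (by fun_prop) α η hW
  refine ⟨?_, hlim, fun t ht => ?_, ?_, ?_⟩
  · filter_upwards [hint] with ω hω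
    exact ⟨fun t ht => integrable_smoothing hα hη hω ht, hω⟩
  · exact memLp_two_of_enorm_le (hvt t ht) (enorm_vScaled_le hα hη ht) hsq
  · exact memLp_two_of_enorm_le hv (enorm_vLimit_le α η W) hsq
  · refine tendsto_eLpNorm_two_of_dominated ?_ hv ?_ (enorm_vLimit_le α η W) hsq hlim
    · filter_upwards [eventually_gt_atTop 0] with t ht using hvt t ht
    · filter_upwards [eventually_gt_atTop 0] with t ht using enorm_vScaled_le hα hη ht

end Convergence

/-! ### Brownian motion in dimensions one and two -/

section Brownian

variable {Ω : Type*} [MeasurableSpace Ω] {P : Measure Ω}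

/-- The mean is zero, so the second moment is the variance `t`. -/
theorem lintegral_enorm_sq_brownian {W : ℝ≥0 → Ω → ℝ} (hW : IsPreBrownianReal W P) (t : ℝ≥0) :
    ∫⁻ ω, ‖W t ω‖ₑ ^ 2 ∂P = t := by
  have : IsProbabilityMeasure P := hW.isGaussianProcess.isProbabilityMeasure
  have h := (hW.isGaussianProcess.hasGaussianLaw_eval t).memLp_two
  have h1 := h.ofReal_variance_eq
  have h2 : Var[W t; P] = t := by
    rw [(hW.hasLaw_eval t).variance_eq, variance_id_gaussianReal]
  rw [h2, evariance, hW.integral_eval] at h1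
  simpa using h1.symm

theorem IsPlanarBrownian.aestronglyMeasurable {W : ℝ≥0 → Ω → EuclideanSpace ℝ (Fin 2)}
    (hW : IsPlanarBrownian W P) (t : ℝ≥0) : AEStronglyMeasurable (W t) P := by
  have h : AEMeasurable (fun ω i => W t ω i) P :=
    aemeasurable_pi_lambda _ fun i => (hW.coord i).aemeasurable t
  exact ((PiLp.continuous_toLp 2 _).measurable.comp_aemeasurable h).aestronglyMeasurable

theorem IsPlanarBrownian.ae_continuous {W : ℝ≥0 → Ω → EuclideanSpace ℝ (Fin 2)}
    (hW : IsPlanarBrownian W P) : ∀ᵐ ω ∂P, Continuous (W · ω) := by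
  have h : ∀ᵐ ω ∂P, ∀ i, Continuous fun t => W t ω i := ae_all_iff.2 fun i => (hW.coord i).cont
  filter_upwards [h] with ω hω
  exact (PiLp.continuous_toLp 2 _).comp (continuous_pi hω)

theorem IsPlanarBrownian.lintegral_enorm_sq {W : ℝ≥0 → Ω → EuclideanSpace ℝ (Fin 2)}
    (hW : IsPlanarBrownian W P) (t : ℝ≥0) : ∫⁻ ω, ‖W t ω‖ₑ ^ 2 ∂P = 2 * t := by
  have h : ∀ ω, ‖W t ω‖ₑ ^ 2 = ∑ i, ‖W t ω i‖ₑ ^ 2 := fun ω => by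
    have h1 := EuclideanSpace.norm_sq_eq (W t ω)
    simp only [← ofReal_norm, ← ENNReal.ofReal_pow (norm_nonneg _), h1]
    exact ENNReal.ofReal_sum_of_nonneg fun i _ => sq_nonneg _
  simp only [h]
  rw [lintegral_finsetSum' _ fun i _ => ((hW.coord i).aemeasurable t).enorm.pow_const 2]
  simp only [lintegral_enorm_sq_brownian (hW.coord _).toIsPreBrownianReal]
  simp

end Brownian

end CongaLine

theorem mainTheorem11 (α η : ℝ) (hα : α ∈ Set.Ioo (0 : ℝ) 1)
    (hη : η ∈ Set.Ioo (0 : ℝ) ((1 - α) / α)) :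
    -- the one-dimensional Conga line
    (∀ (Ω : Type*) [MeasurableSpace Ω] (P : Measure Ω) [IsProbabilityMeasure P]
      (W : ℝ≥0 → Ω → ℝ), IsBrownianReal W P →
      -- the integrals defining `ū(x_t, t)` and `v(η)` converge absolutely, almost surely
      (∀ᵐ ω ∂P, (∀ t : ℝ, 0 < t → Integrable
          (fun z => CongaLine.extend W (t - CongaLine.tailPos α η t / α - z) ω)
          (CongaLine.smoothingLaw α (CongaLine.tailPos α η t))) ∧
        IntegrableOn (CongaLine.limitIntegrand α η W ω) (Set.Ioi 0)) ∧
      -- almost sure convergence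
      (∀ᵐ ω ∂P, Tendsto (fun t : ℝ => CongaLine.vScaled α η W t ω) atTop
        (𝓝 (CongaLine.vLimit α η W ω))) ∧
      -- convergence in `L²`
      (∀ t : ℝ, 0 < t → MemLp (CongaLine.vScaled α η W t) 2 P) ∧
      MemLp (CongaLine.vLimit α η W) 2 P ∧
      Tendsto (fun t : ℝ => eLpNorm (CongaLine.vScaled α η W t - CongaLine.vLimit α η W) 2 P)
        atTop (𝓝 0)) ∧
    -- the two-dimensional Conga line
    (∀ (Ω : Type*) [MeasurableSpace Ω] (P : Measure Ω) [IsProbabilityMeasure P]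
      (W : ℝ≥0 → Ω → EuclideanSpace ℝ (Fin 2)), CongaLine.IsPlanarBrownian W P →
      (∀ᵐ ω ∂P, (∀ t : ℝ, 0 < t → Integrable
          (fun z => CongaLine.extend W (t - CongaLine.tailPos α η t / α - z) ω)
          (CongaLine.smoothingLaw α (CongaLine.tailPos α η t))) ∧
        IntegrableOn (CongaLine.limitIntegrand α η W ω) (Set.Ioi 0)) ∧
      (∀ᵐ ω ∂P, Tendsto (fun t : ℝ => CongaLine.vScaled α η W t ω) atTop
        (𝓝 (CongaLine.vLimit α η W ω))) ∧
      (∀ t : ℝ, 0 < t → MemLp (CongaLine.vScaled α η W t) 2 P) ∧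
      MemLp (CongaLine.vLimit α η W) 2 P ∧
      Tendsto (fun t : ℝ => eLpNorm (CongaLine.vScaled α η W t - CongaLine.vLimit α η W) 2 P)
        atTop (𝓝 0)) := by
  refine ⟨?_, ?_⟩
  · intro Ω _ P _ W hW
    exact CongaLine.tail_convergence hα hη.1 ENNReal.one_ne_top
      (fun t => (hW.aemeasurable t).aestronglyMeasurable) hW.cont
      (fun t => by rw [CongaLine.lintegral_enorm_sq_brownian hW.toIsPreBrownianReal, one_mul])
  · intro Ω _ P _ W hW
    exact CongaLine.tail_convergence hα hη.1 ENNReal.ofNat_ne_top hW.aestronglyMeasurable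
      hW.ae_continuous (fun t => (hW.lintegral_enorm_sq t).le)
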